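/- Let $\kappa\in[0,1)$. Consider quantum strategies consisting of complex Hilbert spaces $\mathcal H_A,\mathcal H_B$ of arbitrary dimension, a (possibly mixed) state $\rho$ on $\mathcal H_A\otimes\mathcal H_B$, two-outcome POVMs $\{E_x^a\}_{a\in\{0,1\}}$ on $\mathcal H_A$ for each input $x\in\{0,1\}$ of Alice, and two-outcome POVMs $\{\Pi_{y,x}^b\}_{b\in\{0,1\}}$ on $\mathcal H_B$, which may depend on Bob's input $y\in\{0,1\}$ and also on Alice's input $x\in\{0,1\}$. Put $A_x=\sum_a(-1)^aE_x^a$, $B_{y,x}=\sum_b(-1)^b\Pi_{y,x}^b$, $p(a,b|x,y)=\operatorname{Tr}\big(\rho\,(E_x^a\otimes \Pi_{y,x}^b)\big)$ and $\langle A_xB_{y,x}\rangle=\sum_{a,b}(-1)^{a+b}p(a,b|x,y)$. Suppose that the leakage of Alice's input is bounded, in operator norm, by $$\|B_{y,0}-B_{y,1}\|\le 2\kappa\qquad (y\in\{0,1\}).$$ Then the maximum over all such strategies of the CHSH expression $$S_{\mathrm{CHSH}}=\langle A_0B_{0,0}\rangle+\langle A_0B_{1,0}\rangle+\langle A_1B_{0,1}\rangle-\langle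 A_1B_{1,1}\rangle$$ exists and equals $$S_{q,\kappa}=\begin{cases}2\sqrt2\,\big(\kappa+\sqrt{1-\kappa^2}\big), & \kappa\in[0,\tfrac1{\sqrt2}],\\ 4,& \kappa\in[\tfrac1{\sqrt2},1).\end{cases}$$ It is attained by the two-qubit state $|\psi\rangle=\frac1{\sqrt2}(|00\rangle+|11\rangle)$ with $A_0=\sigma_z$, $A_1=\sigma_x$ and the following observables of Bob, which satisfy the leakage constraint. For $\kappa\in[0,\frac1{\sqrt2}]$: $$B_{0,0}=\tfrac{-\kappa+\sqrt{1-\kappa^2}}{\sqrt2}\sigma_x+\tfrac{\kappa+\sqrt{1-\kappa^2}}{\sqrt2}\sigma_z,\qquad B_{0,1}=\tfrac{\kappa+\sqrt{1-\kappa^2}}{\sqrt2}\sigma_x+\tfrac{-\kappa+\sqrt{1-\kappa^2}}{\sqrt2}\sigma_z,$$ $$B_{1,0}=\tfrac{\kappa-\sqrt{1-\kappa^2}}{\sqrt2}\sigma_x+\tfrac{\kappa+\sqrt{1-\kappa^2}}{\sqrt2}\sigma_z,\qquad B_{1,1}=\tfrac{-\kappa-\sqrt{1-\kappa^2}}{\sqrt2}\sigma_x+\tfrac{-\kappa+\sqrt{1-\kappa^2}}{\sqrt2}\sigma_z.$$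 For $\kappa\in[\frac1{\sqrt2},1)$: $B_{0,0}=\sigma_z$, $B_{0,1}=\sigma_x$, $B_{1,0}=\sigma_z$, $B_{1,1}=-\sigma_x$. -/

import Mathlib

open scoped TensorProduct InnerProductSpace

universe u v

noncomputable section

namespace LeakyCHSH

/-- The composite Hilbert space of two systems: the completion of the algebraic tensor product. -/
abbrev HilbertTensor (HA : Type u) (HB : Type v)
    [NormedAddCommGroup HA] [InnerProductSpace ℂ HA]
    [NormedAddCommGroup HB] [InnerProductSpace ℂ HB] : Type (max u v) :=
  UniformSpace.Completion (HA ⊗[ℂ] HB)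

/-- The bounded operator `S ⊗ T` on the composite Hilbert space. -/
def opTensor {HA : Type u} {HB : Type v}
    [NormedAddCommGroup HA] [InnerProductSpace ℂ HA]
    [NormedAddCommGroup HB] [InnerProductSpace ℂ HB]
    (S : HA →L[ℂ] HA) (T : HB →L[ℂ] HB) : HilbertTensor HA HB →L[ℂ] HilbertTensor HA HB :=
  (TensorProduct.mapL S T).completion

/-- A (mixed) quantum state `ρ = ∑ₖ pₖ |ψₖ⟩⟨ψₖ|`, with unit vectors `ψₖ` and a probability
distribution `p`. By the spectral theorem every density operator (positive, trace class, of
trace one) on a Hilbert space of any dimension is of this form. -/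
structure MixedState (H : Type u) [NormedAddCommGroup H] [InnerProductSpace ℂ H] where
  weight : ℕ → ℝ
  vec : ℕ → H
  weight_nonneg : ∀ k, 0 ≤ weight k
  hasSum_weight : HasSum weight 1
  norm_vec : ∀ k, ‖vec k‖ = 1

/-- The expectation `Tr (ρ T) = ∑ₖ pₖ ⟨ψₖ, T ψₖ⟩` of an observable `T` (its real part, which is
all of it for self-adjoint `T`). The series converges absolutely, as `|⟨ψₖ, T ψₖ⟩| ≤ ‖T‖`. -/
def MixedState.expect {H : Type u} [NormedAddCommGroup H] [InnerProductSpace ℂ H]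
    (ρ : MixedState H) (T : H →L[ℂ] H) : ℝ :=
  ∑' k, ρ.weight k * (⟪ρ.vec k, T (ρ.vec k)⟫_ℂ).re

/-- The pure state `|ψ⟩⟨ψ|` of a unit vector `ψ`. -/
def MixedState.pure {H : Type u} [NormedAddCommGroup H] [InnerProductSpace ℂ H]
    (ψ : H) (hψ : ‖ψ‖ = 1) : MixedState H where
  weight := Pi.single 0 1
  vec := fun _ => ψ
  weight_nonneg := fun k => by
    by_cases h : k = 0
    · subst h; simp
    · simp [h]
  hasSum_weight := hasSum_pi_single 0 1
  norm_vec := fun _ => hψ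

/-- A two-outcome POVM. -/
structure BinaryPOVM (H : Type u) [NormedAddCommGroup H] [InnerProductSpace ℂ H] where
  effect : Fin 2 → H →L[ℂ] H
  isPositive_effect : ∀ b, (effect b).IsPositive
  sum_effect : ∑ b, effect b = 1

/-- The observable `∑_b (-1)^b Π^b` of a two-outcome POVM `Π`. -/
def BinaryPOVM.observable {H : Type u} [NormedAddCommGroup H] [InnerProductSpace ℂ H]
    (P : BinaryPOVM H) : H →L[ℂ] H :=
  ∑ b : Fin 2, (-1 : ℂ) ^ (b : ℕ) • P.effect b

/-- A quantum strategy in which Bob's measurement `bob y x` may depend on his own input `y` and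
on Alice's input `x`. -/
structure Strategy (HA : Type u) (HB : Type v)
    [NormedAddCommGroup HA] [InnerProductSpace ℂ HA]
    [NormedAddCommGroup HB] [InnerProductSpace ℂ HB] where
  state : MixedState (HilbertTensor HA HB)
  alice : Fin 2 → BinaryPOVM HA
  bob : Fin 2 → Fin 2 → BinaryPOVM HB

namespace Strategy

variable {HA : Type u} {HB : Type v}
  [NormedAddCommGroup HA] [InnerProductSpace ℂ HA]
  [NormedAddCommGroup HB] [InnerProductSpace ℂ HB]

/-- The probability `p(a,b|x,y)`. -/
def prob (S : Strategy HA HB) (a b x y : Fin 2) : ℝ :=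
  S.state.expect (opTensor ((S.alice x).effect a) ((S.bob y x).effect b))

/-- The correlator `⟨A_x B_{y,x}⟩ = ∑_{a,b} (-1)^(a+b) p(a,b|x,y)`. -/
def correlator (S : Strategy HA HB) (x y : Fin 2) : ℝ :=
  ∑ a : Fin 2, ∑ b : Fin 2, (-1 : ℝ) ^ ((a : ℕ) + (b : ℕ)) * S.prob a b x y

/-- The CHSH value `⟨A₀B₀₀⟩ + ⟨A₀B₁₀⟩ + ⟨A₁B₀₁⟩ - ⟨A₁B₁₁⟩`. -/
def chsh (S : Strategy HA HB) : ℝ :=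
  S.correlator 0 0 + S.correlator 0 1 + S.correlator 1 0 - S.correlator 1 1

/-- The leakage constraint `‖B_{y,0} - B_{y,1}‖ ≤ 2κ` for both `y`, in operator norm. -/
def HasLeakage (S : Strategy HA HB) (κ : ℝ) : Prop :=
  ∀ y, ‖(S.bob y 0).observable - (S.bob y 1).observable‖ ≤ 2 * κ

end Strategy

/-- All CHSH values of quantum strategies, on arbitrary Hilbert spaces, under leakage `κ`. -/
def chshValues (κ : ℝ) : Set ℝ :=
  {s | ∃ (HA : Type u) (_ : NormedAddCommGroup HA) (_ : InnerProductSpace ℂ HA)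
      (_ : CompleteSpace HA)
      (HB : Type v) (_ : NormedAddCommGroup HB) (_ : InnerProductSpace ℂ HB)
      (_ : CompleteSpace HB)
      (S : Strategy HA HB), S.HasLeakage κ ∧ S.chsh = s}

/-- The Hilbert space `ℂ²`. -/
abbrev Qubit : Type := EuclideanSpace ℂ (Fin 2)

/-- The computational basis vectors `|0⟩`, `|1⟩`. -/
def ket (i : Fin 2) : Qubit := EuclideanSpace.single i 1

def σx : Qubit →L[ℂ] Qubit := Matrix.toEuclideanCLM (𝕜 := ℂ) !![0, 1; 1, 0]

def σz : Qubit →L[ℂ] Qubit := Matrix.toEuclideanCLM (𝕜 := ℂ) !![1, 0; 0, -1]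

/-- The vector `(|00⟩ + |11⟩) / √2`. -/
def phiPlus : HilbertTensor Qubit Qubit :=
  (((1 / √2 : ℝ) : ℂ) • (ket 0 ⊗ₜ[ℂ] ket 0 + ket 1 ⊗ₜ[ℂ] ket 1) : Qubit ⊗[ℂ] Qubit)

theorem norm_phiPlus : ‖phiPlus‖ = 1 := by
  have h : ‖(ket 0 ⊗ₜ[ℂ] ket 0 + ket 1 ⊗ₜ[ℂ] ket 1 : Qubit ⊗[ℂ] Qubit)‖ = √2 := by
    rw [@norm_eq_sqrt_re_inner ℂ, inner_add_left, inner_add_right, inner_add_right]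
    congr 1
    simp [-inner_self_eq_norm_sq_to_K, TensorProduct.inner_tmul, ket, EuclideanSpace.inner_single_left]
    norm_num
  rw [phiPlus, UniformSpace.Completion.norm_coe, norm_smul, h, Complex.norm_real,
    Real.norm_of_nonneg (by positivity)]
  field_simp

end LeakyCHSH

end

/-! By linearity it suffices to bound the CHSH operator at one unit vector `ψ`. Moving each `A_x` to
the left of the inner product leaves vectors `a_x`, `b_{y,x}` of norm at most 1 with `‖b_{y,0} -
b_{y,1}‖ ≤ 2κ`. Twice the CHSH value is the real part of `⟪a₀ + a₁, (b₀₀ + b₀₁) + (b₁₀ - b₁₁)⟫ + ⟪a₀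
- a₁, (b₀₀ - b₀₁) + (b₁₀ + b₁₁)⟫`. The parallelogram law bounds the squared norms of each
sum-difference pair, and an optimization over these norms (`leakage_real_bound`,
`leakage_vector_bound`) gives `2√2(κ + s)` with `s = √(1 - κ²)`, provided `κ ≤ s`. Otherwise the
algebraic bound 4 is the relevant one. Both bounds are attained on the maximally entangled state,
where correlators of real planar Pauli observables are dot products (`expect_phiPlus_planar`), so a
strategy reduces to a choice of unit vectors in the plane. -/

namespace LeakyCHSH

/-! ### Product operators on the composite space -/

section Operators

variable {HA : Type u} {HB : Type v}
  [NormedAddCommGroup HA] [InnerProductSpace ℂ HA]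
  [NormedAddCommGroup HB] [InnerProductSpace ℂ HB]

theorem opTensor_coe (S : HA →L[ℂ] HA) (T : HB →L[ℂ] HB) (x : HA ⊗[ℂ] HB) :
    opTensor S T (x : HilbertTensor HA HB) = (TensorProduct.mapL S T x : HA ⊗[ℂ] HB) :=
  ContinuousLinearMap.completion_apply_coe _ _

/-- Bounded operators on the composite space agree if they agree on the algebraic tensor
product. -/
theorem hilbertTensor_ext {S T : HilbertTensor HA HB →L[ℂ] HilbertTensor HA HB}
    (h : ∀ x : HA ⊗[ℂ] HB, S (x : HilbertTensor HA HB) = T (x : HilbertTensor HA HB)) : S = T := by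
  ext x
  induction x using UniformSpace.Completion.induction_on with
  | hp => exact isClosed_eq S.continuous T.continuous
  | ih x => exact h x

theorem opTensor_sub_left (S S' : HA →L[ℂ] HA) (T : HB →L[ℂ] HB) :
    opTensor (S - S') T = opTensor S T - opTensor S' T := by
  refine hilbertTensor_ext fun x => ?_
  rw [sub_apply]
  simp only [opTensor_coe]
  rw [eq_sub_iff_add_eq, ← UniformSpace.Completion.coe_add, ← add_apply,
    ← TensorProduct.mapL_add_left, sub_add_cancel]

theorem opTensor_sub_right (S : HA →L[ℂ] HA) (T T' : HB →L[ℂ] HB) :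
    opTensor S (T - T') = opTensor S T - opTensor S T' := by
  refine hilbertTensor_ext fun x => ?_
  rw [sub_apply]
  simp only [opTensor_coe]
  rw [eq_sub_iff_add_eq, ← UniformSpace.Completion.coe_add, ← add_apply,
    ← TensorProduct.mapL_add_right, sub_add_cancel]

theorem opTensor_eq_mul (S : HA →L[ℂ] HA) (T : HB →L[ℂ] HB) :
    opTensor S T = opTensor S 1 * opTensor 1 T := by
  refine hilbertTensor_ext fun x => ?_
  rw [mul_apply_eq_comp]
  simp only [opTensor_coe]
  rw [← mul_apply_eq_comp, ← TensorProduct.mapL_mul, mul_one, one_mul]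

theorem norm_opTensor_le (S : HA →L[ℂ] HA) (T : HB →L[ℂ] HB) :
    ‖opTensor S T‖ ≤ ‖S‖ * ‖T‖ := by
  refine ContinuousLinearMap.opNorm_le_bound _ (by positivity) fun x => ?_
  induction x using UniformSpace.Completion.induction_on with
  | hp => exact isClosed_le (by fun_prop) (by fun_prop)
  | ih x =>
    rw [opTensor_coe, UniformSpace.Completion.norm_coe, UniformSpace.Completion.norm_coe]
    exact (ContinuousLinearMap.le_opNorm _ x).trans
      (mul_le_mul_of_nonneg_right (TensorProduct.norm_mapL_le S T) (norm_nonneg x))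

theorem norm_opTensor_one_left_le (T : HB →L[ℂ] HB) :
    ‖opTensor (1 : HA →L[ℂ] HA) T‖ ≤ ‖T‖ :=
  (norm_opTensor_le 1 T).trans
    (mul_le_of_le_one_left (norm_nonneg T) ContinuousLinearMap.norm_id_le)

theorem norm_opTensor_one_right_le (S : HA →L[ℂ] HA) :
    ‖opTensor S (1 : HB →L[ℂ] HB)‖ ≤ ‖S‖ :=
  (norm_opTensor_le S 1).trans
    (mul_le_of_le_one_right (norm_nonneg S) ContinuousLinearMap.norm_id_le)

end Operators

/-! ### Expectations in mixed states and norms of observables -/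

section States

variable {H : Type u} [NormedAddCommGroup H] [InnerProductSpace ℂ H]

theorem abs_re_inner_le_opNorm (T : H →L[ℂ] H) {ψ : H} (hψ : ‖ψ‖ = 1) :
    |(⟪ψ, T ψ⟫_ℂ).re| ≤ ‖T‖ := by
  have h := (Complex.abs_re_le_norm _).trans (norm_inner_le_norm (𝕜 := ℂ) ψ (T ψ))
  rw [hψ, one_mul] at h
  simpa [hψ] using h.trans (T.le_opNorm ψ)

theorem MixedState.summable_expect (ρ : MixedState H) (T : H →L[ℂ] H) :
    Summable fun k => ρ.weight k * (⟪ρ.vec k, T (ρ.vec k)⟫_ℂ).re := by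
  refine Summable.of_norm_bounded (ρ.hasSum_weight.summable.mul_right ‖T‖) fun k => ?_
  rw [norm_mul, Real.norm_of_nonneg (ρ.weight_nonneg k), Real.norm_eq_abs]
  exact mul_le_mul_of_nonneg_left (abs_re_inner_le_opNorm T (ρ.norm_vec k)) (ρ.weight_nonneg k)

theorem MixedState.expect_add (ρ : MixedState H) (S T : H →L[ℂ] H) :
    ρ.expect (S + T) = ρ.expect S + ρ.expect T := by
  rw [expect, expect, expect, ← (ρ.summable_expect S).tsum_add (ρ.summable_expect T)]
  simp only [add_apply, inner_add_right, Complex.add_re, mul_add]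

theorem MixedState.expect_sub (ρ : MixedState H) (S T : H →L[ℂ] H) :
    ρ.expect (S - T) = ρ.expect S - ρ.expect T := by
  rw [eq_sub_iff_add_eq, ← expect_add, sub_add_cancel]

theorem MixedState.expect_le (ρ : MixedState H) {T : H →L[ℂ] H} {c : ℝ}
    (h : ∀ ψ : H, ‖ψ‖ = 1 → (⟪ψ, T ψ⟫_ℂ).re ≤ c) : ρ.expect T ≤ c := by
  have := (ρ.summable_expect T).tsum_le_tsum
    (fun k => mul_le_mul_of_nonneg_left (h _ (ρ.norm_vec k)) (ρ.weight_nonneg k))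
    (ρ.hasSum_weight.summable.mul_right c)
  rwa [tsum_mul_right, ρ.hasSum_weight.tsum_eq, one_mul] at this

theorem MixedState.expect_pure (ψ : H) (hψ : ‖ψ‖ = 1) (T : H →L[ℂ] H) :
    (MixedState.pure ψ hψ).expect T = (⟪ψ, T ψ⟫_ℂ).re := by
  rw [expect, tsum_eq_single 0]
  · simp [pure]
  · intro k hk
    simp [pure, hk]

theorem BinaryPOVM.observable_eq_sub (P : BinaryPOVM H) :
    P.observable = P.effect 0 - P.effect 1 := by
  simp [observable, Fin.sum_univ_two, sub_eq_add_neg]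

/-- Positivity and normalization bound the quadratic form of the symmetric operator `T` by `‖z‖²`;
polarization turns this into a norm bound, without completeness of `H`. -/
theorem BinaryPOVM.norm_observable_le_one (P : BinaryPOVM H) : ‖P.observable‖ ≤ 1 := by
  refine ContinuousLinearMap.opNorm_le_bound _ zero_le_one fun x => ?_
  rw [observable_eq_sub, one_mul]
  have hpos (b : Fin 2) (z : H) : 0 ≤ (⟪z, P.effect b z⟫_ℂ).re :=
    (P.isPositive_effect b).re_inner_nonneg_right z
  have hsum (z : H) : (⟪z, P.effect 0 z⟫_ℂ).re + (⟪z, P.effect 1 z⟫_ℂ).re = ‖z‖ ^ 2 := by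
    rw [← Complex.add_re, ← inner_add_right, ← add_apply, ← Fin.sum_univ_two P.effect,
      P.sum_effect, one_apply_eq_self]
    exact inner_self_eq_norm_sq (𝕜 := ℂ) z
  set T := P.effect 0 - P.effect 1 with hT
  have hsymm (y z : H) : ⟪T y, z⟫_ℂ = ⟪y, T z⟫_ℂ := by
    simp only [hT, sub_apply, inner_sub_left, inner_sub_right,
      (P.isPositive_effect _).inner_left_eq_inner_right]
  have hform (z : H) : |(⟪z, T z⟫_ℂ).re| ≤ ‖z‖ ^ 2 := by
    rw [← hsum, hT, sub_apply, inner_sub_right, Complex.sub_re, abs_le]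
    constructor <;> linarith [hpos 0 z, hpos 1 z]
  -- Subtracting the forms at `x ± T x` gives `4‖T x‖² ≤ ‖x + T x‖² + ‖x - T x‖² = 2‖x‖² + 2‖T x‖²`.
  have h1 := (abs_le.1 (hform (x + T x))).2
  have h2 := (abs_le.1 (hform (x - T x))).1
  have hpar := parallelogram_law_with_norm ℂ x (T x)
  have hself : (⟪T x, T x⟫_ℂ).re = ‖T x‖ ^ 2 := inner_self_eq_norm_sq (𝕜 := ℂ) (T x)
  simp only [map_add, map_sub, inner_add_left, inner_sub_left, inner_add_right, inner_sub_right,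
    Complex.add_re, Complex.sub_re, ← hsymm x (T x), hself] at h1 h2
  refine abs_le_of_sq_le_sq' ?_ (norm_nonneg x) |>.2
  linarith

end States

/-! ### The upper bound -/

theorem leakage_real_bound {κ s p q m d m' d' : ℝ} (hκ : 0 ≤ κ) (hκs : κ ≤ s)
    (hs : κ ^ 2 + s ^ 2 = 1) (hd : 0 ≤ d) (hd' : 0 ≤ d')
    (hpq : p ^ 2 + q ^ 2 ≤ 4) (hmd : m ^ 2 + d ^ 2 ≤ 4) (hmd' : m' ^ 2 + d' ^ 2 ≤ 4)
    (hdκ : d ≤ 2 * κ) (hdκ' : d' ≤ 2 * κ) :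
    p * (m + d') + q * (d + m') ≤ 4 * √2 * (κ + s) := by
  have hd2 : d ^ 2 ≤ 4 * κ ^ 2 := by nlinarith
  have hd2' : d' ^ 2 ≤ 4 * κ ^ 2 := by nlinarith
  have hκs2 : 0 ≤ s ^ 2 - κ ^ 2 := by nlinarith
  -- Weighted AM-GM, `2κs·md' ≤ κ²m² + s²d'²`, has equality at `m = 2s`, `d' = 2κ`. Eliminating `m²`
  -- and `m'²` leaves `8κ² + (s² - κ²)(d² + d'²)`; since `κ ≤ s`, this is at most its value `16κ²s²`
  -- at `d = d' = 2κ`. The weights degenerate at `κ = 0`, hence the case split.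
  have cross : m * d' + m' * d ≤ 8 * (κ * s) := by
    rcases hκ.eq_or_lt with rfl | hκ
    · have h1 : d = 0 := by linarith
      have h2 : d' = 0 := by linarith
      simp [h1, h2]
    · have hpos : 0 < κ * s := mul_pos hκ (hκ.trans_le hκs)
      refine le_of_mul_le_mul_left ?_ hpos
      nlinarith [sq_nonneg (κ * m - s * d'), sq_nonneg (κ * m' - s * d),
        mul_le_mul_of_nonneg_left hd2 hκs2, mul_le_mul_of_nonneg_left hd2' hκs2,
        mul_le_mul_of_nonneg_left hmd (sq_nonneg κ), mul_le_mul_of_nonneg_left hmd' (sq_nonneg κ)]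
  -- The squares contribute at most 8 and the cross terms at most `16κs`; `κ² + s² = 1` completes
  -- the square.
  have hsq : (m + d') ^ 2 + (d + m') ^ 2 ≤ 8 * (κ + s) ^ 2 := by nlinarith
  have h2 : √2 ^ 2 = 2 := Real.sq_sqrt (by norm_num)
  refine abs_le_of_sq_le_sq' ?_ (mul_nonneg (by positivity) (by linarith)) |>.2
  calc (p * (m + d') + q * (d + m')) ^ 2
      ≤ (p ^ 2 + q ^ 2) * ((m + d') ^ 2 + (d + m') ^ 2) := by
        nlinarith [sq_nonneg (p * (d + m') - q * (m + d'))]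
    _ ≤ 4 * (8 * (κ + s) ^ 2) := by gcongr
    _ = (4 * √2 * (κ + s)) ^ 2 := by rw [mul_pow, mul_pow, h2]; ring

section Vectors

variable {H : Type u} [NormedAddCommGroup H] [InnerProductSpace ℂ H]

theorem norm_add_sq_add_norm_sub_sq_le {x y : H} (hx : ‖x‖ ≤ 1) (hy : ‖y‖ ≤ 1) :
    ‖x + y‖ ^ 2 + ‖x - y‖ ^ 2 ≤ 4 := by
  have := parallelogram_law_with_norm ℂ x y
  nlinarith [norm_nonneg x, norm_nonneg y]

/-- The CHSH bound for vectors in place of operators. -/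
theorem leakage_vector_bound {κ s : ℝ} (hκ : 0 ≤ κ) (hκs : κ ≤ s) (hs : κ ^ 2 + s ^ 2 = 1)
    {a₀ a₁ b₀₀ b₀₁ b₁₀ b₁₁ : H} (ha₀ : ‖a₀‖ ≤ 1) (ha₁ : ‖a₁‖ ≤ 1)
    (hb₀₀ : ‖b₀₀‖ ≤ 1) (hb₀₁ : ‖b₀₁‖ ≤ 1) (hb₁₀ : ‖b₁₀‖ ≤ 1) (hb₁₁ : ‖b₁₁‖ ≤ 1)
    (h₀ : ‖b₀₀ - b₀₁‖ ≤ 2 * κ) (h₁ : ‖b₁₀ - b₁₁‖ ≤ 2 * κ) :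
    (⟪a₀, b₀₀⟫_ℂ).re + (⟪a₀, b₁₀⟫_ℂ).re + (⟪a₁, b₀₁⟫_ℂ).re - (⟪a₁, b₁₁⟫_ℂ).re
      ≤ 2 * √2 * (κ + s) := by
  have hre (x y z : H) : (⟪x, y + z⟫_ℂ).re ≤ ‖x‖ * (‖y‖ + ‖z‖) :=
    (Complex.re_le_norm _).trans <| (norm_inner_le_norm _ _).trans <|
      mul_le_mul_of_nonneg_left (norm_add_le _ _) (norm_nonneg _)
  have h1 := hre (a₀ + a₁) (b₀₀ + b₀₁) (b₁₀ - b₁₁)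
  have h2 := hre (a₀ - a₁) (b₀₀ - b₀₁) (b₁₀ + b₁₁)
  have h3 := leakage_real_bound hκ hκs hs (norm_nonneg (b₀₀ - b₀₁))
    (norm_nonneg (b₁₀ - b₁₁))
    (norm_add_sq_add_norm_sub_sq_le ha₀ ha₁) (norm_add_sq_add_norm_sub_sq_le hb₀₀ hb₀₁)
    (norm_add_sq_add_norm_sub_sq_le hb₁₀ hb₁₁) h₀ h₁
  simp only [inner_add_left, inner_sub_left, inner_add_right, inner_sub_right, Complex.add_re,
    Complex.sub_re] at h1 h2
  linarith

end Vectors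

namespace Strategy

variable {HA : Type u} {HB : Type v}
  [NormedAddCommGroup HA] [InnerProductSpace ℂ HA]
  [NormedAddCommGroup HB] [InnerProductSpace ℂ HB]

theorem correlator_eq_expect (S : Strategy HA HB) (x y : Fin 2) :
    S.correlator x y =
      S.state.expect (opTensor (S.alice x).observable (S.bob y x).observable) := by
  simp only [correlator, prob, Fin.sum_univ_two, BinaryPOVM.observable_eq_sub, opTensor_sub_left,
    opTensor_sub_right, MixedState.expect_sub]
  simp
  ring

theorem chsh_eq_expect (S : Strategy HA HB) :
    S.chsh = S.state.expect (opTensor (S.alice 0).observable (S.bob 0 0).observable +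
      opTensor (S.alice 0).observable (S.bob 1 0).observable +
      opTensor (S.alice 1).observable (S.bob 0 1).observable -
      opTensor (S.alice 1).observable (S.bob 1 1).observable) := by
  simp only [chsh, correlator_eq_expect, MixedState.expect_add, MixedState.expect_sub]

theorem chsh_le_four (S : Strategy HA HB) : S.chsh ≤ 4 := by
  rw [chsh_eq_expect]
  refine S.state.expect_le fun ψ hψ => ?_
  have h (x y : Fin 2) := abs_le.1 ((abs_re_inner_le_opNorm
    (opTensor (S.alice x).observable (S.bob y x).observable) hψ).trans <|
      (norm_opTensor_le _ _).trans <| mul_le_one₀ (BinaryPOVM.norm_observable_le_one _)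
        (norm_nonneg _) (BinaryPOVM.norm_observable_le_one _))
  simp only [add_apply, sub_apply, inner_add_right, inner_sub_right, Complex.add_re,
    Complex.sub_re]
  linarith [h 0 0, h 0 1, h 1 0, h 1 1]

theorem chsh_le_of_hasLeakage (S : Strategy HA HB) {κ s : ℝ} (hκ : 0 ≤ κ) (hκs : κ ≤ s)
    (hs : κ ^ 2 + s ^ 2 = 1) (hS : S.HasLeakage κ) : S.chsh ≤ 2 * √2 * (κ + s) := by
  rw [chsh_eq_expect]
  refine S.state.expect_le fun ψ hψ => ?_
  have hle {T : HilbertTensor HA HB →L[ℂ] HilbertTensor HA HB} {c : ℝ} (hT : ‖T‖ ≤ c) :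
      ‖T ψ‖ ≤ c := by simpa [hψ] using T.le_of_opNorm_le hT ψ
  -- Taking the adjoint of Alice's factor splits `⟪ψ, (A ⊗ B) ψ⟫` into an inner product of two
  -- vectors, using only the norm of `A`.
  have hA (x : Fin 2) : ‖ContinuousLinearMap.adjoint
      (opTensor (S.alice x).observable (1 : HB →L[ℂ] HB)) ψ‖ ≤ 1 := by
    refine hle ?_
    rw [LinearIsometryEquiv.norm_map]
    exact (norm_opTensor_one_right_le _).trans (BinaryPOVM.norm_observable_le_one _)
  have hB (y x : Fin 2) : ‖opTensor (1 : HA →L[ℂ] HA) (S.bob y x).observable ψ‖ ≤ 1 :=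
    hle ((norm_opTensor_one_left_le _).trans (BinaryPOVM.norm_observable_le_one _))
  have hD (y : Fin 2) : ‖opTensor (1 : HA →L[ℂ] HA) (S.bob y 0).observable ψ -
      opTensor (1 : HA →L[ℂ] HA) (S.bob y 1).observable ψ‖ ≤ 2 * κ := by
    rw [← sub_apply, ← opTensor_sub_right]
    exact hle ((norm_opTensor_one_left_le _).trans (hS y))
  have := leakage_vector_bound hκ hκs hs (hA 0) (hA 1) (hB 0 0) (hB 0 1) (hB 1 0) (hB 1 1)
    (hD 0) (hD 1)
  simp only [ContinuousLinearMap.adjoint_inner_left, ← mul_apply_eq_comp,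
    ← opTensor_eq_mul] at this
  simpa only [add_apply, sub_apply, inner_add_right,
    inner_sub_right, Complex.add_re, Complex.sub_re] using this

end Strategy

/-! ### Optimal qubit strategies -/

section Reflections

variable {H : Type u} [NormedAddCommGroup H] [InnerProductSpace ℂ H] [CompleteSpace H]

/-- `(1 + T)/2` is the orthogonal projection onto the `+1` eigenspace of `T`. -/
theorem isPositive_half_one_add {T : H →L[ℂ] H} (hT : IsSelfAdjoint T) (hT2 : T * T = 1) :
    ((1 / 2 : ℂ) • (1 + T)).IsPositive := by
  refine ContinuousLinearMap.IsPositive.of_isStarProjection ⟨?_, ?_⟩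
  · rw [IsIdempotentElem, smul_mul_smul_comm, mul_add, add_mul, add_mul, hT2]
    simp only [one_mul, mul_one]
    module
  · refine IsSelfAdjoint.smul ?_ ((IsSelfAdjoint.one _).add hT)
    simp [IsSelfAdjoint]

/-- The projective measurement whose observable is the self-adjoint unitary `T`. -/
noncomputable def BinaryPOVM.ofReflection (T : H →L[ℂ] H) (hT : IsSelfAdjoint T)
    (hT2 : T * T = 1) : BinaryPOVM H where
  effect := ![(1 / 2 : ℂ) • (1 + T), (1 / 2 : ℂ) • (1 + -T)]
  isPositive_effect b := by
    fin_cases b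
    · exact isPositive_half_one_add hT hT2
    · exact isPositive_half_one_add hT.neg (by rw [neg_mul_neg, hT2])
  sum_effect := by
    simp only [Fin.sum_univ_two, Matrix.cons_val_zero, Matrix.cons_val_one]
    module

theorem BinaryPOVM.observable_ofReflection (T : H →L[ℂ] H) (hT : IsSelfAdjoint T)
    (hT2 : T * T = 1) : (ofReflection T hT hT2).observable = T := by
  rw [observable_eq_sub]
  simp only [ofReflection, Matrix.cons_val_zero, Matrix.cons_val_one]
  module

end Reflections

/-- The qubit observable `α σx + β σz`. -/
noncomputable def planar (α β : ℝ) : Qubit →L[ℂ] Qubit := (α : ℂ) • σx + (β : ℂ) • σz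

theorem planar_eq_toEuclideanCLM (α β : ℝ) :
    planar α β = Matrix.toEuclideanCLM (𝕜 := ℂ) !![(β : ℂ), α; α, -β] := by
  rw [planar, σx, σz, ← map_smul (Matrix.toEuclideanCLM (n := Fin 2) (𝕜 := ℂ)),
    ← map_smul (Matrix.toEuclideanCLM (n := Fin 2) (𝕜 := ℂ)), ← map_add]
  congr 1
  ext i j
  fin_cases i <;> fin_cases j <;> simp

theorem isSelfAdjoint_planar (α β : ℝ) : IsSelfAdjoint (planar α β) := by
  rw [planar_eq_toEuclideanCLM, IsSelfAdjoint, ← map_star]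
  congr 1
  ext i j
  fin_cases i <;> fin_cases j <;> simp [Matrix.star_apply]

theorem planar_mul_self (α β : ℝ) :
    planar α β * planar α β = ((α ^ 2 + β ^ 2 : ℝ) : ℂ) • 1 := by
  rw [planar_eq_toEuclideanCLM, ← map_mul, ← map_one (Matrix.toEuclideanCLM (𝕜 := ℂ)), ← map_smul]
  congr 1
  ext i j
  fin_cases i <;> fin_cases j <;> simp [Matrix.mul_apply, Fin.sum_univ_two] <;> ring

theorem planar_mul_self_eq_one {α β : ℝ} (h : α ^ 2 + β ^ 2 = 1) :
    planar α β * planar α β = 1 := by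
  rw [planar_mul_self, h, Complex.ofReal_one, one_smul]

/-- The C*-identity reduces the norm to the scalar square. Leakage thus becomes Euclidean distance
in the plane. -/
theorem norm_planar_sq (α β : ℝ) : ‖planar α β‖ ^ 2 = α ^ 2 + β ^ 2 := by
  rw [sq, ← CStarRing.norm_star_mul_self, (isSelfAdjoint_planar α β).star_eq, planar_mul_self,
    norm_smul, norm_one, mul_one, Complex.norm_real, Real.norm_of_nonneg (by positivity)]

theorem planar_sub (α β γ δ : ℝ) : planar α β - planar γ δ = planar (α - γ) (β - δ) := by
  simp only [planar, Complex.ofReal_sub]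
  module

theorem planar_ket_zero (α β : ℝ) : planar α β (ket 0) = (β : ℂ) • ket 0 + (α : ℂ) • ket 1 := by
  rw [planar_eq_toEuclideanCLM, ket, ket]
  ext i
  rw [Matrix.ofLp_toEuclideanCLM]
  fin_cases i <;> simp

theorem planar_ket_one (α β : ℝ) : planar α β (ket 1) = (α : ℂ) • ket 0 - (β : ℂ) • ket 1 := by
  rw [planar_eq_toEuclideanCLM, ket, ket]
  ext i
  rw [Matrix.ofLp_toEuclideanCLM]
  fin_cases i <;> simp

theorem inner_ket (i j : Fin 2) : ⟪ket i, ket j⟫_ℂ = if i = j then 1 else 0 := by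
  simp [ket, EuclideanSpace.inner_single_left]

theorem expect_phiPlus_planar (α β γ δ : ℝ) :
    (MixedState.pure phiPlus norm_phiPlus).expect (opTensor (planar α β) (planar γ δ)) =
      α * γ + β * δ := by
  set Φ : Qubit ⊗[ℂ] Qubit := ket 0 ⊗ₜ[ℂ] ket 0 + ket 1 ⊗ₜ[ℂ] ket 1 with hΦ
  have hφ : phiPlus = ((1 / √2 : ℝ) : ℂ) • (Φ : HilbertTensor Qubit Qubit) :=
    UniformSpace.Completion.coe_smul _ _
  have h : ⟪Φ, TensorProduct.mapL (planar α β) (planar γ δ) Φ⟫_ℂ =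
      ((2 * (α * γ + β * δ) : ℝ) : ℂ) := by
    rw [hΦ, map_add, TensorProduct.mapL_tmul, TensorProduct.mapL_tmul, planar_ket_zero,
      planar_ket_one, planar_ket_zero, planar_ket_one]
    simp only [inner_add_left, inner_add_right, inner_sub_right, inner_smul_right,
      TensorProduct.inner_tmul, inner_ket]
    simp
    ring
  have h2 : 1 / √2 * (1 / √2) = 1 / 2 := by
    rw [div_mul_div_comm, Real.mul_self_sqrt (by norm_num), one_mul]
  rw [MixedState.expect_pure, hφ, map_smul, inner_smul_left, inner_smul_right, opTensor_coe,
    UniformSpace.Completion.inner_coe, h, Complex.conj_ofReal, ← mul_assoc, ← Complex.ofReal_mul,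
    ← Complex.ofReal_mul, Complex.ofReal_re, h2]
  ring

/-- The strategy on the maximally entangled state in which Alice measures `σz`, `σx` and Bob
measures `α y x • σx + β y x • σz`. -/
noncomputable def planarStrategy (α β : Fin 2 → Fin 2 → ℝ)
    (h : ∀ y x, α y x ^ 2 + β y x ^ 2 = 1) : Strategy Qubit Qubit where
  state := MixedState.pure phiPlus norm_phiPlus
  alice := ![.ofReflection (planar 0 1) (isSelfAdjoint_planar _ _)
      (planar_mul_self_eq_one (by norm_num)),
    .ofReflection (planar 1 0) (isSelfAdjoint_planar _ _) (planar_mul_self_eq_one (by norm_num))]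
  bob y x := .ofReflection (planar (α y x) (β y x)) (isSelfAdjoint_planar _ _)
    (planar_mul_self_eq_one (h y x))

section PlanarStrategy

variable (α β : Fin 2 → Fin 2 → ℝ) (h : ∀ y x, α y x ^ 2 + β y x ^ 2 = 1)

theorem observable_alice_zero_planarStrategy :
    ((planarStrategy α β h).alice 0).observable = planar 0 1 :=
  BinaryPOVM.observable_ofReflection _ (isSelfAdjoint_planar _ _)
    (planar_mul_self_eq_one (by norm_num))

theorem observable_alice_one_planarStrategy :
    ((planarStrategy α β h).alice 1).observable = planar 1 0 :=
  BinaryPOVM.observable_ofReflection _ (isSelfAdjoint_planar _ _)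
    (planar_mul_self_eq_one (by norm_num))

theorem observable_bob_planarStrategy (y x : Fin 2) :
    ((planarStrategy α β h).bob y x).observable = planar (α y x) (β y x) :=
  BinaryPOVM.observable_ofReflection _ (isSelfAdjoint_planar _ _)
    (planar_mul_self_eq_one (h y x))

theorem hasLeakage_planarStrategy {κ : ℝ} (hκ : 0 ≤ κ)
    (hle : ∀ y, (α y 0 - α y 1) ^ 2 + (β y 0 - β y 1) ^ 2 ≤ 4 * κ ^ 2) :
    (planarStrategy α β h).HasLeakage κ := fun y => by
  rw [observable_bob_planarStrategy, observable_bob_planarStrategy, planar_sub]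
  refine abs_le_of_sq_le_sq' ?_ (by positivity) |>.2
  rw [norm_planar_sq]
  linarith [hle y]

theorem chsh_planarStrategy :
    (planarStrategy α β h).chsh = β 0 0 + β 1 0 + α 0 1 - α 1 1 := by
  have hs : (planarStrategy α β h).state = MixedState.pure phiPlus norm_phiPlus := rfl
  simp only [Strategy.chsh, Strategy.correlator_eq_expect, observable_bob_planarStrategy,
    observable_alice_zero_planarStrategy, observable_alice_one_planarStrategy, hs,
    expect_phiPlus_planar]
  ring

end PlanarStrategy

theorem planar_zero_one : planar 0 1 = σz := by
  rw [planar, Complex.ofReal_zero, Complex.ofReal_one]; module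

theorem planar_one_zero : planar 1 0 = σx := by
  rw [planar, Complex.ofReal_zero, Complex.ofReal_one]; module

/-- Bob's optimal observables under leakage `κ ≤ 1 / √2`. -/
theorem exists_strategy_of_le {κ s : ℝ} (hκ : 0 ≤ κ) (hs : κ ^ 2 + s ^ 2 = 1) :
    ∃ S : Strategy Qubit Qubit,
      S.state = MixedState.pure phiPlus norm_phiPlus ∧
      (S.alice 0).observable = σz ∧ (S.alice 1).observable = σx ∧
      (S.bob 0 0).observable = planar ((-κ + s) / √2) ((κ + s) / √2) ∧
      (S.bob 0 1).observable = planar ((κ + s) / √2) ((-κ + s) / √2) ∧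
      (S.bob 1 0).observable = planar ((κ - s) / √2) ((κ + s) / √2) ∧
      (S.bob 1 1).observable = planar ((-κ - s) / √2) ((-κ + s) / √2) ∧
      S.HasLeakage κ ∧ S.chsh = 2 * √2 * (κ + s) := by
  have h2 : √2 ^ 2 = 2 := Real.sq_sqrt (by norm_num)
  refine ⟨planarStrategy
    ![![(-κ + s) / √2, (κ + s) / √2], ![(κ - s) / √2, (-κ - s) / √2]]
    ![![(κ + s) / √2, (-κ + s) / √2], ![(κ + s) / √2, (-κ + s) / √2]] ?_, rfl,
    (observable_alice_zero_planarStrategy _ _ _).trans planar_zero_one,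
    (observable_alice_one_planarStrategy _ _ _).trans planar_one_zero,
    observable_bob_planarStrategy _ _ _ _ _, observable_bob_planarStrategy _ _ _ _ _,
    observable_bob_planarStrategy _ _ _ _ _, observable_bob_planarStrategy _ _ _ _ _,
    hasLeakage_planarStrategy _ _ _ hκ ?_, (chsh_planarStrategy _ _ _).trans ?_⟩
  · intro y x
    fin_cases y <;> fin_cases x <;> simp [div_pow] <;> linarith
  · intro y
    -- Both coordinates change by `2κ/√2` in absolute value, so the leakage constraint is saturated.
    fin_cases y <;> simp [← sub_div, div_pow] <;> apply le_of_eq <;> ring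
  · simp
    field_simp
    rw [h2]
    ring

/-- Bob's optimal observables under leakage `κ ≥ 1 / √2`. -/
theorem exists_strategy_of_ge {κ : ℝ} (hκ : 0 ≤ κ) (hκ2 : 1 ≤ 2 * κ ^ 2) :
    ∃ S : Strategy Qubit Qubit,
      S.state = MixedState.pure phiPlus norm_phiPlus ∧
      (S.alice 0).observable = σz ∧ (S.alice 1).observable = σx ∧
      (S.bob 0 0).observable = σz ∧ (S.bob 0 1).observable = σx ∧
      (S.bob 1 0).observable = σz ∧ (S.bob 1 1).observable = -σx ∧
      S.HasLeakage κ ∧ S.chsh = 4 := by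
  refine ⟨planarStrategy ![![0, 1], ![0, -1]] ![![1, 0], ![1, 0]] ?_, rfl,
    (observable_alice_zero_planarStrategy _ _ _).trans planar_zero_one,
    (observable_alice_one_planarStrategy _ _ _).trans planar_one_zero,
    (observable_bob_planarStrategy _ _ _ _ _).trans planar_zero_one,
    (observable_bob_planarStrategy _ _ _ _ _).trans planar_one_zero,
    (observable_bob_planarStrategy _ _ _ _ _).trans planar_zero_one,
    (observable_bob_planarStrategy _ _ _ _ _).trans (by
      change planar (-1) 0 = _
      rw [planar, Complex.ofReal_zero, Complex.ofReal_neg, Complex.ofReal_one]; module),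
    hasLeakage_planarStrategy _ _ _ hκ ?_, (chsh_planarStrategy _ _ _).trans ?_⟩
  · intro y x
    fin_cases y <;> fin_cases x <;> simp
  · intro y
    -- The squared distance between `σz` and `±σx` is 2, and `2 ≤ 4κ²` is exactly the threshold `κ ≥
    -- 1/√2`.
    fin_cases y <;> simp <;> linarith
  · simp
    norm_num

/-! ### The maximum over all strategies -/

theorem upperBound_of_le {κ s : ℝ} (hκ : 0 ≤ κ) (hκs : κ ≤ s) (hs : κ ^ 2 + s ^ 2 = 1) :
    2 * √2 * (κ + s) ∈ upperBounds (chshValues.{u, v} κ) := by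
  rintro _ ⟨HA, _, _, _, HB, _, _, _, S, hS, rfl⟩
  exact S.chsh_le_of_hasLeakage hκ hκs hs hS

theorem four_mem_upperBounds (κ : ℝ) : 4 ∈ upperBounds (chshValues.{u, v} κ) := by
  rintro _ ⟨HA, _, _, _, HB, _, _, _, S, hS, rfl⟩
  exact S.chsh_le_four

/-- `Qubit` lives in universe 0, so attainment is recorded there, while the upper bounds hold in
every universe. -/
theorem chsh_mem_chshValues {S : Strategy Qubit Qubit} {κ c : ℝ} (hS : S.HasLeakage κ)
    (hc : S.chsh = c) : c ∈ chshValues.{0, 0} κ :=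
  ⟨Qubit, inferInstance, inferInstance, inferInstance, Qubit, inferInstance, inferInstance,
    inferInstance, S, hS, hc⟩

end LeakyCHSH

theorem mainTheorem5 (κ : ℝ) (hκ0 : 0 ≤ κ) (hκ1 : κ < 1) :
    (κ ≤ 1 / √2 →
      IsGreatest (LeakyCHSH.chshValues.{0, 0} κ) (2 * √2 * (κ + √(1 - κ ^ 2))) ∧
      2 * √2 * (κ + √(1 - κ ^ 2)) ∈ upperBounds (LeakyCHSH.chshValues.{u, v} κ) ∧
      ∃ S : LeakyCHSH.Strategy LeakyCHSH.Qubit LeakyCHSH.Qubit,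
        S.state = LeakyCHSH.MixedState.pure LeakyCHSH.phiPlus LeakyCHSH.norm_phiPlus ∧
        (S.alice 0).observable = LeakyCHSH.σz ∧
        (S.alice 1).observable = LeakyCHSH.σx ∧
        (S.bob 0 0).observable =
          (((-κ + √(1 - κ ^ 2)) / √2 : ℝ) : ℂ) • LeakyCHSH.σx +
            (((κ + √(1 - κ ^ 2)) / √2 : ℝ) : ℂ) • LeakyCHSH.σz ∧
        (S.bob 0 1).observable =
          (((κ + √(1 - κ ^ 2)) / √2 : ℝ) : ℂ) • LeakyCHSH.σx +
            (((-κ + √(1 - κ ^ 2)) / √2 : ℝ) : ℂ) • LeakyCHSH.σz ∧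
        (S.bob 1 0).observable =
          (((κ - √(1 - κ ^ 2)) / √2 : ℝ) : ℂ) • LeakyCHSH.σx +
            (((κ + √(1 - κ ^ 2)) / √2 : ℝ) : ℂ) • LeakyCHSH.σz ∧
        (S.bob 1 1).observable =
          (((-κ - √(1 - κ ^ 2)) / √2 : ℝ) : ℂ) • LeakyCHSH.σx +
            (((-κ + √(1 - κ ^ 2)) / √2 : ℝ) : ℂ) • LeakyCHSH.σz ∧
        S.HasLeakage κ ∧
        S.chsh = 2 * √2 * (κ + √(1 - κ ^ 2))) ∧
    (1 / √2 ≤ κ →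
      IsGreatest (LeakyCHSH.chshValues.{0, 0} κ) 4 ∧
      4 ∈ upperBounds (LeakyCHSH.chshValues.{u, v} κ) ∧
      ∃ S : LeakyCHSH.Strategy LeakyCHSH.Qubit LeakyCHSH.Qubit,
        S.state = LeakyCHSH.MixedState.pure LeakyCHSH.phiPlus LeakyCHSH.norm_phiPlus ∧
        (S.alice 0).observable = LeakyCHSH.σz ∧
        (S.alice 1).observable = LeakyCHSH.σx ∧
        (S.bob 0 0).observable = LeakyCHSH.σz ∧
        (S.bob 0 1).observable = LeakyCHSH.σx ∧
        (S.bob 1 0).observable = LeakyCHSH.σz ∧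
        (S.bob 1 1).observable = -LeakyCHSH.σx ∧
        S.HasLeakage κ ∧
        S.chsh = 4) := by
  constructor
  · intro hκ
    have hκ2 : κ ^ 2 ≤ 1 / 2 := by
      have := pow_le_pow_left₀ hκ0 hκ 2
      rwa [div_pow, Real.sq_sqrt (by norm_num), one_pow] at this
    have hs : κ ^ 2 + √(1 - κ ^ 2) ^ 2 = 1 := by
      rw [Real.sq_sqrt (by linarith)]
      ring
    have hκs : κ ≤ √(1 - κ ^ 2) := Real.le_sqrt_of_sq_le (by linarith)
    obtain ⟨S, hS⟩ := LeakyCHSH.exists_strategy_of_le hκ0 hs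
    obtain ⟨-, -, -, -, -, -, -, hL, hc⟩ := id hS
    exact ⟨⟨LeakyCHSH.chsh_mem_chshValues hL hc, LeakyCHSH.upperBound_of_le hκ0 hκs hs⟩,
      LeakyCHSH.upperBound_of_le hκ0 hκs hs, S, hS⟩
  · intro hκ
    have hκ2 : 1 / 2 ≤ κ ^ 2 := by
      have := pow_le_pow_left₀ (by positivity) hκ 2
      rwa [div_pow, Real.sq_sqrt (by norm_num), one_pow] at this
    obtain ⟨S, hS⟩ := LeakyCHSH.exists_strategy_of_ge hκ0 (by linarith)
    obtain ⟨-, -, -, -, -, -, -, hL, hc⟩ := id hS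
    exact ⟨⟨LeakyCHSH.chsh_mem_chshValues hL hc, LeakyCHSH.four_mem_upperBounds κ⟩,
      LeakyCHSH.four_mem_upperBounds κ, S, hS⟩
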